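/- Let $q$ be a prime power and let $V=V(n,q)$ be an $n$-dimensional vector space over the field with $q$ elements. A subspace partition of $V$ is a collection $\mathcal P$ of nonzero subspaces of $V$ such that every nonzero vector of $V$ lies in exactly one member of $\mathcal P$. For $1\le t<n'$, let $\sigma_q(n',t)$ denote the minimum number of subspaces in a subspace partition of $V(n',q)$ whose largest member has dimension $t$. Let $\mathcal P$ be a subspace partition of $V$, let $d_1<d_2<\dots<d_m$ be the distinct dimensions of the members of $\mathcal P$, and let $n_{d}$ be the number of $d$-dimensional members of $\mathcal P$. Let $2\le s\le m$, and let $ST$ be the $d_s$-supertail of $\mathcal P$, i.e. the set of members of $\mathcal P$ of dimension less than $d_s$. Suppose that $|ST|=\sigma_q(d_s,d_{s-1})$ and $d_s<2d_{s-1}$, and that at least one of the following conditions holds: (i) $s-1\le 2$, that is, the members of $ST$ have at most two different dimensions; (ii) $d_s=2d_{s-1}-1$; (iii) all the subspaces in $\mathcal P\setminus ST$ have the same dimension. Then the union of the subspaces in $ST$ is a subspace $W$ of $V$. Moreover, either (a) $s-1=1$, $n_{d_1}=q^{d_1}+1$ and $\dim W=2d_1$ (so $ST$ is a partition of $W$ into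 $q^{d_1}+1$ subspaces of dimension $d_1$), or (b) $s-1=2$, $n_{d_1}=q^{d_2}$, $n_{d_2}=1$ and $\dim W=d_1+d_2$ (so $ST$ is a partition of $W$ into one $d_2$-subspace and $q^{d_2}$ $d_1$-subspaces). -/

import Mathlib

/-- A subspace partition of `V`: a collection of nonzero subspaces of `V` such that every nonzero
vector of `V` lies in exactly one of them. -/
def IsSubspacePartition {F V : Type*} [Field F] [AddCommGroup V] [Module F V]
    (P : Set (Submodule F V)) : Prop :=
  (∀ U ∈ P, U ≠ ⊥) ∧ ∀ v : V, v ≠ 0 → ∃! U : Submodule F V, U ∈ P ∧ v ∈ U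

/-- The set of dimensions that occur in a collection of subspaces. -/
noncomputable def dimSet {F V : Type*} [Field F] [AddCommGroup V] [Module F V]
    (P : Set (Submodule F V)) : Set ℕ :=
  (fun U : Submodule F V => Module.finrank F U) '' P

/-- The number of members of dimension `k` in a collection of subspaces. -/
noncomputable def numOfDim {F V : Type*} [Field F] [AddCommGroup V] [Module F V]
    (P : Set (Submodule F V)) (k : ℕ) : ℕ :=
  {U ∈ P | Module.finrank F U = k}.ncard

/-- The distinct dimensions that occur in `P` are exactly `d 1 < d 2 < ⋯ < d m`. The values of `d`
outside `{1, …, m}` play no role. -/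
def HasDims {F V : Type*} [Field F] [AddCommGroup V] [Module F V]
    (P : Set (Submodule F V)) (m : ℕ) (d : ℕ → ℕ) : Prop :=
  StrictMonoOn d (Set.Icc 1 m) ∧ d '' Set.Icc 1 m = dimSet P

/-- The `k`-supertail of `P`: the members of `P` of dimension less than `k`. -/
def supertail {F V : Type*} [Field F] [AddCommGroup V] [Module F V]
    (P : Set (Submodule F V)) (k : ℕ) : Set (Submodule F V) :=
  {U ∈ P | Module.finrank F U < k}

/-- `σ_q(n,t)` for `q = |F|`: the minimum size of a subspace partition of the `n`-dimensional space
over `F` in which the largest subspace has dimension `t`. -/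
noncomputable def minPartitionSize (F : Type*) [Field F] (n t : ℕ) : ℕ :=
  sInf {k : ℕ | ∃ P : Set (Submodule F (Fin n → F)),
    IsSubspacePartition P ∧ IsGreatest (dimSet P) t ∧ P.ncard = k}

open Module

set_option linter.unusedSectionVars false

section

variable {F V : Type*} [Field F] [Finite F] [AddCommGroup V] [Module F V] [FiniteDimensional F V]

/-! Let `A` be the supertail, `U` a member of its largest dimension `t = d (s - 1)`, and `N = q ^
t`. For `t < d s < 2 * t` one has `σ_q(d s, t) = q ^ t + 1`, so `A` has `N + 1` members. For a
functional `f`, let `w(f)` (`kernelWeight`) be the total size of the members of `A` inside `ker f`,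
and let `S = w(0)`. Disjointness alone fixes the first two moments of `w`, and they give `∑ (w(f) -
N) * (S - w(f)) = 0`.

The partition makes all `w(f)` congruent modulo `q ^ d s ≥ 2 * N`. Averaging over the annihilator of
`U` then forces `w ≥ N` (`natCard_le_kernelWeight`). Every term of the sum is therefore zero and `w`
takes only the values `N` and `S`. The first moment now shows that the span of `A` has `S - N`
elements, as many as the union of `A`, so the union is a subspace `W` (`coe_sup_eq_biUnion`).
Counting the points of `W` outside `U` forces the other `q ^ t` members to have dimension `dim W -
t`, which leaves only the two listed types. -/

theorem Submodule.natCard_pos (U : Submodule F V) : 0 < Nat.card U := by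
  have : Finite V := Module.finite_of_finite F
  exact Nat.card_pos

theorem Submodule.two_le_natCard {U : Submodule F V} (hU : U ≠ ⊥) : 2 ≤ Nat.card U := by
  have : Finite V := Module.finite_of_finite F
  have : Nontrivial U := (Submodule.nontrivial_iff_ne_bot).2 hU
  exact Finite.one_lt_card

/-! ### Sizes of annihilators and of level sets. -/

theorem Submodule.natCard_dualAnnihilator_mul (U : Submodule F V) :
    Nat.card U.dualAnnihilator * Nat.card U = Nat.card V := by
  rw [Module.natCard_eq_pow_finrank (K := F), Module.natCard_eq_pow_finrank (K := F) (V := U),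
    Module.natCard_eq_pow_finrank (K := F) (V := V), ← pow_add, add_comm,
    Subspace.finrank_add_finrank_dualAnnihilator_eq]

theorem Submodule.natCard_sup_of_disjoint {U U' : Submodule F V} (h : Disjoint U U') :
    Nat.card ↥(U ⊔ U') = Nat.card U * Nat.card U' := by
  have := Submodule.finrank_sup_add_finrank_inf_eq U U'
  rw [h.eq_bot, finrank_bot, add_zero] at this
  rw [Module.natCard_eq_pow_finrank (K := F), Module.natCard_eq_pow_finrank (K := F) (V := U),
    Module.natCard_eq_pow_finrank (K := F) (V := U'), ← pow_add, this]

theorem Submodule.natCard_dualAnnihilator_inf_mul {U U' : Submodule F V} (h : Disjoint U U') :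
    Nat.card ↥(U.dualAnnihilator ⊓ U'.dualAnnihilator) * Nat.card U' =
      Nat.card U.dualAnnihilator := by
  rw [← Submodule.dualAnnihilator_sup_eq]
  apply Nat.eq_of_mul_eq_mul_right U.natCard_pos
  rw [U.natCard_dualAnnihilator_mul, ← (U ⊔ U').natCard_dualAnnihilator_mul,
    natCard_sup_of_disjoint h]
  ring

/-- A nonzero functional takes the value one on a fraction `1 / |F|` of the space. -/
theorem Module.Dual.natCard_level_mul {f : Dual F V} (hf : f ≠ 0) :
    Nat.card {v : V // f v = 1} * Nat.card F = Nat.card V := by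
  obtain ⟨x, hx⟩ : ∃ x, f x ≠ 0 := by
    by_contra! h
    exact hf (LinearMap.ext h)
  obtain ⟨u, hu⟩ : ∃ u, f u = 1 := ⟨(f x)⁻¹ • x, by simp [hx]⟩
  rw [← Nat.card_prod]
  -- Translation along `u` identifies the product of the level set with `F` and the whole space.
  refine Nat.card_congr
    { toFun := fun p => p.1.1 + p.2 • u
      invFun := fun v => (⟨v - (f v - 1) • u, by simp [hu]⟩, f v - 1)
      left_inv := ?_
      right_inv := ?_ }
  · rintro ⟨⟨w, hw⟩, c⟩
    simp [hw, hu]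
  · intro v
    simp

/-! ### Kernel weights and their moments. -/

open Classical in
/-- The total size of the members of `A` that lie in the kernel of `f`. -/
noncomputable def kernelWeight (A : Finset (Submodule F V)) (f : Dual F V) : ℕ :=
  ∑ U ∈ A, if f ∈ U.dualAnnihilator then Nat.card U else 0

open Classical in
theorem sum_mem_submodule_card {W : Type*} [AddCommGroup W] [Module F W] [Fintype W]
    (X : Submodule F W) (c : ℕ) : (∑ f : W, if f ∈ X then c else 0) = Nat.card X * c := by
  rw [← Finset.sum_filter, Finset.sum_const, smul_eq_mul]
  congr 1
  rw [Nat.card_eq_fintype_card, Fintype.card_subtype]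

theorem kernelWeight_zero (A : Finset (Submodule F V)) :
    kernelWeight A 0 = ∑ U ∈ A, Nat.card U := by
  simp [kernelWeight]

theorem sum_kernelWeight [Fintype (Dual F V)] (A : Finset (Submodule F V)) :
    ∑ f, kernelWeight A f = Nat.card V * A.card := by
  simp only [kernelWeight]
  rw [Finset.sum_comm]
  simp only [sum_mem_submodule_card, Submodule.natCard_dualAnnihilator_mul, Finset.sum_const,
    smul_eq_mul]
  ring

-- A member `X ≠ U` is disjoint from `U`, so it contributes `|U^⊥ ∩ X^⊥| * |X| = |U^⊥|` whatever its
-- dimension; `U` itself contributes `|U^⊥| * |U|`.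
open Classical in
theorem sum_kernelWeight_dualAnnihilator [Fintype (Dual F V)] {A : Finset (Submodule F V)}
    (hA : (A : Set (Submodule F V)).Pairwise Disjoint) {U : Submodule F V} (hU : U ∈ A) :
    (∑ f, if f ∈ U.dualAnnihilator then kernelWeight A f else 0) =
      Nat.card U.dualAnnihilator * (Nat.card U + (A.erase U).card) := by
  have h : ∀ f : Dual F V, (if f ∈ U.dualAnnihilator then kernelWeight A f else 0) =
      ∑ X ∈ A, if f ∈ U.dualAnnihilator ⊓ X.dualAnnihilator then Nat.card X else 0 := by
    intro f
    by_cases hf : f ∈ U.dualAnnihilator <;> simp only [hf, Submodule.mem_inf, kernelWeight] <;> simp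
  simp only [h]
  rw [Finset.sum_comm]
  simp only [sum_mem_submodule_card]
  rw [← Finset.add_sum_erase A _ hU, inf_idem, mul_add]
  congr 1
  rw [Finset.sum_congr rfl (g := fun _ => Nat.card U.dualAnnihilator)]
  · simp [mul_comm]
  · intro X hX
    exact Submodule.natCard_dualAnnihilator_inf_mul
      (hA hU (Finset.mem_of_mem_erase hX) (Finset.ne_of_mem_erase hX).symm)

open Classical in
theorem sum_kernelWeight_sq [Fintype (Dual F V)] {A : Finset (Submodule F V)} {N : ℕ}
    (hA : (A : Set (Submodule F V)).Pairwise Disjoint) (hN : A.card = N + 1) :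
    ∑ f, kernelWeight A f * kernelWeight A f =
      Nat.card V * (∑ U ∈ A, Nat.card U + (N + 1) * N) := by
  have h : ∀ f : Dual F V, kernelWeight A f * kernelWeight A f =
      ∑ U ∈ A, Nat.card U * if f ∈ U.dualAnnihilator then kernelWeight A f else 0 := by
    intro f
    conv_lhs => enter [1]; rw [kernelWeight]
    rw [Finset.sum_mul]
    refine Finset.sum_congr rfl fun U _ => ?_
    split_ifs <;> simp
  simp only [h]
  rw [Finset.sum_comm]
  simp only [← Finset.mul_sum]
  rw [Finset.sum_congr rfl (g := fun U : Submodule F V => Nat.card V * (Nat.card U + N))]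
  · rw [← Finset.mul_sum, Finset.sum_add_distrib]
    simp [hN]
  · intro U hU
    rw [sum_kernelWeight_dualAnnihilator hA hU, ← U.natCard_dualAnnihilator_mul,
      Finset.card_erase_of_mem hU, hN, Nat.add_sub_cancel]
    ring

/-! ### From weight bounds to a union that is a subspace. -/

/-- If the kernel weights agree modulo a number that is at least twice the size of a member `U` of
`A`, and `A` has `|U| + 1` members, then every kernel weight is at least `|U|`. -/
theorem natCard_le_kernelWeight {A : Finset (Submodule F V)}
    (hA : (A : Set (Submodule F V)).Pairwise Disjoint) (hbot : ∀ X ∈ A, X ≠ ⊥)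
    {U : Submodule F V} (hU : U ∈ A) (hcard : A.card = Nat.card U + 1) {E : ℕ}
    (hE : 2 * Nat.card U ≤ E)
    (hmod : ∀ f f' : Dual F V, kernelWeight A f ≡ kernelWeight A f' [MOD E]) (f : Dual F V) :
    Nat.card U ≤ kernelWeight A f := by
  classical
  by_contra! hlt
  have : Finite (Dual F V) := Module.finite_of_finite F
  let := Fintype.ofFinite (Dual F V)
  -- Such an `f'` has weight at least `|U|`, hence strictly above that of `f`, and the congruence
  -- makes the gap at least `E`.
  have hge : ∀ f' ∈ U.dualAnnihilator, E ≤ kernelWeight A f' := by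
    intro f' hf'
    have h1 : Nat.card U ≤ kernelWeight A f' := by
      rw [kernelWeight]
      have := Finset.single_le_sum
        (f := fun X : Submodule F V => if f' ∈ X.dualAnnihilator then Nat.card X else 0)
        (fun _ _ => Nat.zero_le _) hU
      simpa only [hf', if_true] using this
    have h2 := (Nat.modEq_iff_dvd' (hlt.le.trans h1)).1 (hmod f f')
    have h3 := Nat.le_of_dvd (by omega) h2
    omega
  -- At `0` all members count, and each of the `|U|` others has at least two elements; this gives
  -- strictness.
  have hlarge : 2 * Nat.card U < kernelWeight A 0 := by
    rw [kernelWeight_zero, ← Finset.add_sum_erase A _ hU]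
    have h1 : (A.erase U).card * 2 ≤ ∑ X ∈ A.erase U, Nat.card X := by
      rw [← smul_eq_mul]
      exact Finset.card_nsmul_le_sum _ _ _
        fun X hX => Submodule.two_le_natCard (hbot X (Finset.mem_of_mem_erase hX))
    rw [Finset.card_erase_of_mem hU, hcard] at h1
    have := U.natCard_pos
    omega
  -- The mean weight on the annihilator of `U` is exactly `|U| + (|A| - 1) = 2 * |U|`, which
  -- contradicts the two bounds above.
  have hs := sum_kernelWeight_dualAnnihilator hA hU
  have : (∑ f : Dual F V, if f ∈ U.dualAnnihilator then 2 * Nat.card U else 0) <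
      ∑ f, if f ∈ U.dualAnnihilator then kernelWeight A f else 0 := by
    refine Finset.sum_lt_sum (fun f' _ => ?_) ⟨0, Finset.mem_univ _, ?_⟩
    · split_ifs with h
      · exact hE.trans (hge f' h)
      · rfl
    · simpa only [Submodule.zero_mem, if_true] using hlarge
  rw [sum_mem_submodule_card, hs, Finset.card_erase_of_mem hU, hcard, Nat.add_sub_cancel,
    two_mul] at this
  exact lt_irrefl _ this

theorem kernelWeight_eq_iff (A : Finset (Submodule F V)) (f : Dual F V) :
    kernelWeight A f = ∑ U ∈ A, Nat.card U ↔ f ∈ (A.sup id).dualAnnihilator := by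
  classical
  rw [kernelWeight, Finset.sum_eq_sum_iff_of_le (fun U _ => by split_ifs <;> simp)]
  have h : f ∈ (A.sup id).dualAnnihilator ↔ ∀ U ∈ A, f ∈ U.dualAnnihilator := by
    simp only [Submodule.mem_dualAnnihilator, ← LinearMap.mem_ker]
    exact Finset.sup_le_iff (s := A) (f := id) (a := LinearMap.ker f)
  rw [h]
  refine forall₂_congr fun U _ => ?_
  have := U.natCard_pos
  split_ifs with hf
  · simp [hf]
  · exact iff_of_false this.ne hf

theorem kernelWeight_le (A : Finset (Submodule F V)) (f : Dual F V) :
    kernelWeight A f ≤ ∑ U ∈ A, Nat.card U := by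
  classical
  exact Finset.sum_le_sum fun U _ => by split_ifs <;> simp

/-- If `A` has `N + 1` members and every kernel weight is at least `N`, then the sum of the members
is as large as their union. -/
theorem natCard_sup_add {A : Finset (Submodule F V)} {N : ℕ}
    (hA : (A : Set (Submodule F V)).Pairwise Disjoint) (hN : A.card = N + 1)
    (hle : ∀ f : Dual F V, N ≤ kernelWeight A f) :
    Nat.card (A.sup id : Submodule F V) + N = ∑ U ∈ A, Nat.card U := by
  classical
  have : Finite (Dual F V) := Module.finite_of_finite F
  have : Finite V := Module.finite_of_finite F
  let := Fintype.ofFinite (Dual F V)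
  set S := ∑ U ∈ A, Nat.card U with hS
  set v : ℤ := (Nat.card V : ℤ)
  have hdual : (Finset.univ : Finset (Dual F V)).card = Nat.card V := by
    rw [Finset.card_univ, ← Nat.card_eq_fintype_card,
      Module.natCard_eq_pow_finrank (K := F), Subspace.dual_finrank_eq,
      ← Module.natCard_eq_pow_finrank (K := F)]
  have h1 : ∑ f : Dual F V, (kernelWeight A f : ℤ) = v * (N + 1) := by
    have := congrArg (Nat.cast (R := ℤ)) (sum_kernelWeight A)
    rw [hN] at this
    push_cast at this
    exact this
  have h2 : ∑ f : Dual F V, (kernelWeight A f : ℤ) * kernelWeight A f =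
      v * (S + (N + 1) * N) := by
    have := congrArg (Nat.cast (R := ℤ)) (sum_kernelWeight_sq hA hN)
    rw [← hS] at this
    push_cast at this
    exact this
  -- The quadratic with roots `N` and `S` is the one whose sum the two moments make vanish.
  have h3 : ∑ f : Dual F V, ((kernelWeight A f : ℤ) - N) * (S - kernelWeight A f) = 0 := by
    have : ∀ f : Dual F V, ((kernelWeight A f : ℤ) - N) * (S - kernelWeight A f) =
        (S + N) * kernelWeight A f - kernelWeight A f * kernelWeight A f - N * S := by
      intro f; ring
    simp only [this, Finset.sum_sub_distrib, ← Finset.mul_sum, h1, h2, Finset.sum_const,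
      nsmul_eq_mul, hdual]
    ring
  have h4 : ∀ f : Dual F V, ((kernelWeight A f : ℤ) - N) * (S - kernelWeight A f) = 0 := by
    intro f
    refine (Finset.sum_eq_zero_iff_of_nonneg fun f _ => ?_).1 h3 f (Finset.mem_univ _)
    have := hle f
    have := kernelWeight_le A f
    exact mul_nonneg (by omega) (by omega)
  have h5 : ∀ f : Dual F V, kernelWeight A f =
      N + if f ∈ (A.sup id).dualAnnihilator then S - N else 0 := by
    intro f
    have hN' := hle f
    have hS' := kernelWeight_le A f
    split_ifs with hf
    · rw [(kernelWeight_eq_iff A f).2 hf]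
      omega
    · have hne := mt (kernelWeight_eq_iff A f).1 hf
      rcases mul_eq_zero.1 (h4 f) with h | h <;> omega
  -- With only two values, the first moment reads `|V| = |(sup A)^⊥| * (S - N)`, so `|sup A| = S -
  -- N`.
  have h6 := sum_kernelWeight A
  simp only [h5, Finset.sum_add_distrib, sum_mem_submodule_card, Finset.sum_const, smul_eq_mul,
    hN] at h6
  rw [hdual, mul_add, Nat.add_left_cancel_iff, mul_one,
    ← (A.sup id).natCard_dualAnnihilator_mul] at h6
  have h7 := Nat.eq_of_mul_eq_mul_left (Submodule.natCard_pos _) h6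
  have h8 := (hle 0).trans (kernelWeight_le A 0)
  omega

/-- The nonzero parts are disjoint, so only the zero vector is counted once per member. -/
theorem ncard_biUnion_add_card {A : Finset (Submodule F V)}
    (hA : (A : Set (Submodule F V)).Pairwise Disjoint) (hne : A.Nonempty) :
    (⋃ U ∈ A, (U : Set V)).ncard + A.card = (∑ U ∈ A, Nat.card U) + 1 := by
  classical
  have : Finite V := Module.finite_of_finite F
  let := Fintype.ofFinite V
  have h1 : (⋃ U ∈ A, (U : Set V)) =
      insert 0 ((A.biUnion fun U => {v : V | v ∈ U ∧ v ≠ 0} : Finset V) : Set V) := by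
    ext v
    simp only [Set.mem_iUnion, SetLike.mem_coe, exists_prop, Set.mem_insert_iff,
      Finset.mem_biUnion, Finset.mem_filter, Finset.mem_univ, true_and]
    constructor
    · rintro ⟨U, hU, hv⟩
      by_cases h : v = 0
      · exact Or.inl h
      · exact Or.inr ⟨U, hU, hv, h⟩
    · rintro (rfl | ⟨U, hU, hv, -⟩)
      · exact ⟨hne.choose, hne.choose_spec, zero_mem _⟩
      · exact ⟨U, hU, hv⟩
  have h2 : ∀ U : Submodule F V,
      ({v : V | v ∈ U ∧ v ≠ 0} : Finset V).card + 1 = Nat.card U := by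
    intro U
    have : ({v : V | v ∈ U ∧ v ≠ 0} : Finset V) = ({v : V | v ∈ U} : Finset V).erase 0 := by
      ext v
      simp [and_comm]
    rw [this, Finset.card_erase_add_one (by simp), Nat.card_eq_fintype_card, Fintype.card_subtype]
  rw [h1, Set.ncard_insert_of_notMem (by simp), Set.ncard_coe_finset, Finset.card_biUnion,
    ← Finset.sum_congr rfl fun U _ => h2 U, Finset.sum_add_distrib]
  · simp
    ring
  · intro U hU X hX hUX
    rw [Function.onFun, Finset.disjoint_left]
    simp only [Finset.mem_filter, Finset.mem_univ, true_and]
    rintro v ⟨hv, hv0⟩ ⟨hv', -⟩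
    exact hv0 (Submodule.disjoint_def.1 (hA hU hX hUX) v hv hv')

/-- A finite family of subspaces satisfying the hypotheses of `natCard_sup_add` has a subspace as
its union. -/
theorem coe_sup_eq_biUnion {A : Finset (Submodule F V)} {N : ℕ}
    (hA : (A : Set (Submodule F V)).Pairwise Disjoint) (hN : A.card = N + 1)
    (hle : ∀ f : Dual F V, N ≤ kernelWeight A f) :
    ((A.sup id : Submodule F V) : Set V) = ⋃ U ∈ A, (U : Set V) := by
  have : Finite V := Module.finite_of_finite F
  symm
  refine Set.eq_of_subset_of_ncard_le ?_ ?_ (Set.toFinite _)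
  · exact Set.iUnion₂_subset fun U hU => Finset.le_sup (f := id) hU
  · have h1 := natCard_sup_add hA hN hle
    have h2 := ncard_biUnion_add_card hA (Finset.card_pos.1 (by omega))
    have h3 : ((A.sup id : Submodule F V) : Set V).ncard = Nat.card (A.sup id : Submodule F V) := rfl
    omega

/-! ### The congruence for kernel weights in a subspace partition. -/

open Classical in
/-- In a subspace partition, the members outside the kernel of a nonzero functional have total size
`|V|`. -/
theorem sum_natCard_not_mem_dualAnnihilator {B : Finset (Submodule F V)}
    (hB : IsSubspacePartition (B : Set (Submodule F V))) {f : Dual F V} (hf : f ≠ 0) :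
    (∑ U ∈ B, if f ∈ U.dualAnnihilator then 0 else Nat.card U) = Nat.card V := by
  have : Finite V := Module.finite_of_finite F
  let := Fintype.ofFinite V
  -- A member not in `ker f` meets the level set `f = 1` in `|U| / |F|` vectors; this level set
  -- avoids zero, so the partition splits it.
  have h1 : ∀ U : Submodule F V, (if f ∈ U.dualAnnihilator then 0 else Nat.card U) =
      ({v : V | v ∈ U ∧ f v = 1} : Finset V).card * Nat.card F := by
    intro U
    split_ifs with h
    · rw [Submodule.mem_dualAnnihilator] at h
      have : ({v : V | v ∈ U ∧ f v = 1} : Finset V) = ∅ := by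
        ext v
        simp only [Finset.mem_filter, Finset.mem_univ, true_and, Finset.notMem_empty, iff_false]
        rintro ⟨hv, hv'⟩
        simp [h v hv] at hv'
      simp [this]
    · have hne : f.domRestrict U ≠ 0 := by
        intro h0
        refine h ((Submodule.mem_dualAnnihilator f).2 fun w hw => ?_)
        exact LinearMap.congr_fun h0 ⟨w, hw⟩
      rw [← Module.Dual.natCard_level_mul hne]
      congr 1
      rw [← Fintype.card_subtype, ← Nat.card_eq_fintype_card]
      exact Nat.card_congr (Equiv.subtypeSubtypeEquivSubtypeInter (· ∈ U) (f · = 1))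
  simp only [h1]
  rw [← Finset.sum_mul, ← Module.Dual.natCard_level_mul hf, Nat.card_eq_fintype_card (α := {v // _}),
    Fintype.card_subtype, ← Finset.card_biUnion]
  · congr 2
    ext v
    simp only [Finset.mem_biUnion, Finset.mem_filter, Finset.mem_univ, true_and]
    constructor
    · rintro ⟨U, -, -, h⟩
      exact h
    · intro h
      obtain ⟨U, ⟨hU, hv⟩, -⟩ := hB.2 v (by rintro rfl; simp at h)
      exact ⟨U, hU, hv, h⟩
  · intro U hU X hX hUX
    rw [Function.onFun, Finset.disjoint_left]
    simp only [Finset.mem_filter, Finset.mem_univ, true_and]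
    rintro v ⟨hv, hv1⟩ ⟨hv', -⟩
    exact hUX ((hB.2 v (by rintro rfl; simp at hv1)).unique ⟨hU, hv⟩ ⟨hX, hv'⟩)

theorem IsSubspacePartition.pairwise_disjoint {P : Set (Submodule F V)}
    (hP : IsSubspacePartition P) : P.Pairwise Disjoint := by
  intro U hU X hX hUX
  rw [Submodule.disjoint_def]
  intro v hv hv'
  by_contra h0
  exact hUX ((hP.2 v h0).unique ⟨hU, hv⟩ ⟨hX, hv'⟩)

/-- The members outside `ker f` have total size `|V|` when `f ≠ 0`. Both `|V|` and the share of the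
members not in `A` are divisible by `|F| ^ e`, hence so is the share of `A`, which is `w(0) - w(f)`.
-/
theorem IsSubspacePartition.modEq_kernelWeight {A B : Finset (Submodule F V)}
    (hB : IsSubspacePartition (B : Set (Submodule F V))) (hAB : A ⊆ B) {e : ℕ}
    (he : ∀ U ∈ B, U ∉ A → e ≤ finrank F U) (heV : e ≤ finrank F V) (f : Dual F V) :
    kernelWeight A f ≡ kernelWeight A 0 [MOD Nat.card F ^ e] := by
  classical
  have hcompl : kernelWeight A 0 =
      kernelWeight A f + ∑ U ∈ A, if f ∈ U.dualAnnihilator then 0 else Nat.card U := by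
    rw [kernelWeight_zero, kernelWeight, ← Finset.sum_add_distrib]
    exact Finset.sum_congr rfl fun U _ => by split_ifs <;> simp
  have hdvd : Nat.card F ^ e ∣ ∑ U ∈ A, if f ∈ U.dualAnnihilator then 0 else Nat.card U := by
    rcases eq_or_ne f 0 with rfl | hf
    · simp
    · have hsum := sum_natCard_not_mem_dualAnnihilator hB hf
      rw [← Finset.sum_sdiff hAB] at hsum
      have hrest : Nat.card F ^ e ∣
          ∑ U ∈ B \ A, if f ∈ U.dualAnnihilator then 0 else Nat.card U := by
        refine Finset.dvd_sum fun U hU => ?_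
        rw [Finset.mem_sdiff] at hU
        split_ifs
        · exact dvd_zero _
        · rw [Module.natCard_eq_pow_finrank (K := F) (V := U)]
          exact pow_dvd_pow _ (he U hU.1 hU.2)
      rw [← Nat.dvd_add_right hrest, hsum, Module.natCard_eq_pow_finrank (K := F) (V := V)]
      exact pow_dvd_pow _ heV
  rw [hcompl]
  exact (Nat.modEq_iff_dvd' (Nat.le_add_right _ _)).2 (by rwa [Nat.add_sub_cancel_left])

/-! ### Point counts and the minimum size of a partition. -/

/-- If the union of `A` is a subspace `W`, this counts the points of `W` outside a member `U`. -/
theorem sum_erase_pow_sub_one {A : Finset (Submodule F V)}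
    (hA : (A : Set (Submodule F V)).Pairwise Disjoint) {W : Submodule F V}
    (hW : (W : Set V) = ⋃ U ∈ A, (U : Set V)) {U : Submodule F V} (hU : U ∈ A) :
    ∑ X ∈ A.erase U, (Nat.card F ^ finrank F X - 1) =
      Nat.card F ^ finrank F U * (Nat.card F ^ (finrank F W - finrank F U) - 1) := by
  classical
  have hUW : U ≤ W := by
    intro v hv
    have : v ∈ (W : Set V) := hW ▸ Set.mem_biUnion hU hv
    exact this
  have h1 := ncard_biUnion_add_card hA ⟨U, hU⟩
  have h2 : (W : Set V).ncard = Nat.card W := rfl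
  rw [← hW, h2, ← Finset.add_sum_erase A _ hU, ← Finset.card_erase_add_one hU,
    Module.natCard_eq_pow_finrank (K := F) (V := W),
    Module.natCard_eq_pow_finrank (K := F) (V := U)] at h1
  have h3 : ∑ X ∈ A.erase U, (Nat.card F ^ finrank F X - 1) + (A.erase U).card =
      ∑ X ∈ A.erase U, Nat.card X := by
    rw [Finset.card_eq_sum_ones, ← Finset.sum_add_distrib]
    refine Finset.sum_congr rfl fun X _ => ?_
    have := X.natCard_pos
    rw [Module.natCard_eq_pow_finrank (K := F) (V := X)] at this ⊢
    omega
  rw [Nat.mul_sub, ← pow_add, Nat.add_sub_cancel' (Submodule.finrank_mono hUW)]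
  omega

theorem finrank_le_sub_of_disjoint {U X W : Submodule F V} (h : Disjoint U X) (hU : U ≤ W)
    (hX : X ≤ W) : finrank F X ≤ finrank F W - finrank F U := by
  have h1 := Submodule.finrank_sup_add_finrank_inf_eq U X
  rw [h.eq_bot, finrank_bot] at h1
  have := Submodule.finrank_mono (sup_le hU hX)
  omega

theorem Submodule.exists_finrank_eq {n : ℕ} (hn : n ≤ finrank F V) :
    ∃ U : Submodule F V, finrank F U = n := by
  obtain ⟨s, hs, hli⟩ := exists_finset_linearIndependent_of_le_finrank hn
  exact ⟨Submodule.span F (s : Set V), (finrank_span_finset_eq_card hli).trans hs⟩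

theorem exists_field_extension_finrank_eq (F : Type*) [Field F] [Finite F] {n : ℕ} (hn : n ≠ 0) :
    ∃ (K : Type) (_ : Field K) (_ : Algebra F K), FiniteDimensional F K ∧ finrank F K = n := by
  obtain ⟨p, hp⟩ := CharP.exists F
  have : Fact p.Prime := ⟨CharP.char_is_prime F p⟩
  have : NeZero n := ⟨hn⟩
  exact ⟨FiniteField.Extension F p n, inferInstance, inferInstance, inferInstance,
    FiniteField.finrank_extension F p n⟩

/-- A space of dimension `n` with `t < n < 2 * t` is partitioned by one subspace of dimension `t`
and `q ^ t` subspaces of dimension `n - t`: inside `K × U`, with `K` the field extension of degree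
`t` and `U` a subspace of `K`, take the first factor and the graphs of the multiplications by the
elements of `K`. -/
theorem exists_isSubspacePartition {t : ℕ} (h1 : t < finrank F V) (h2 : finrank F V < 2 * t) :
    ∃ P : Set (Submodule F V), IsSubspacePartition P ∧ IsGreatest (dimSet P) t ∧
      P.ncard = Nat.card F ^ t + 1 := by
  obtain ⟨K, _, _, _, hK⟩ := exists_field_extension_finrank_eq F (n := t) (by omega)
  obtain ⟨U, hU⟩ := Submodule.exists_finrank_eq (F := F) (V := K) (n := finrank F V - t) (by omega)
  obtain ⟨φ⟩ : Nonempty (V ≃ₗ[F] K × U) :=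
    FiniteDimensional.nonempty_linearEquiv_of_finrank_eq (by rw [finrank_prod]; omega)
  have : Finite K := Module.finite_of_finite F
  let p : V →ₗ[F] K := LinearMap.fst F K U ∘ₗ φ.toLinearMap
  let r : V →ₗ[F] U := LinearMap.snd F K U ∘ₗ φ.toLinearMap
  let g : K → V →ₗ[F] K := fun a => p - LinearMap.mulLeft F a ∘ₗ U.subtype ∘ₗ r
  have hr : Function.Surjective r := (LinearMap.snd_surjective (R := F)).comp φ.surjective
  have hgv : ∀ a v, v ∈ LinearMap.ker (g a) ↔ p v = a * (r v : K) := by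
    intro a v
    simp [g, sub_eq_zero]
  have hp : ∀ x, ∃ v, p v = x ∧ r v = 0 := fun x => ⟨φ.symm (x, 0), by simp [p, r]⟩
  have hg : ∀ a, Function.Surjective (g a) := by
    intro a x
    obtain ⟨v, hv, hv'⟩ := hp x
    exact ⟨v, by simp [g, hv, hv']⟩
  have hzero : ∀ v, p v = 0 → r v = 0 → v = 0 := by
    intro v hv hv'
    exact φ.map_eq_zero_iff.1 (Prod.ext hv hv')
  have hdr : finrank F (LinearMap.ker r) = t := by
    have := LinearMap.finrank_range_add_finrank_ker r
    rw [LinearMap.range_eq_top.2 hr, finrank_top] at this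
    omega
  have hdg : ∀ a, finrank F (LinearMap.ker (g a)) = finrank F V - t := by
    intro a
    have := LinearMap.finrank_range_add_finrank_ker (g a)
    rw [LinearMap.range_eq_top.2 (hg a), finrank_top] at this
    omega
  have hinj : Function.Injective fun a => LinearMap.ker (g a) := by
    intro a b hab
    obtain ⟨u, hu⟩ : ∃ u : U, u ≠ 0 := by
      have : Nontrivial U := (finrank_pos_iff (R := F)).1 (by omega)
      exact exists_ne 0
    have ha : φ.symm (a * u, u) ∈ LinearMap.ker (g a) := by
      rw [hgv]
      simp [p, r]
    have hb : φ.symm (a * u, u) ∈ LinearMap.ker (g b) := by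
      have hab' : LinearMap.ker (g a) = LinearMap.ker (g b) := hab
      rwa [← hab']
    rw [hgv] at hb
    simpa [p, r, hu] using hb
  refine ⟨insert (LinearMap.ker r) (Set.range fun a => LinearMap.ker (g a)),
    ⟨?_, fun v hv => ?_⟩, ⟨?_, ?_⟩, ?_⟩
  · rintro X (rfl | ⟨a, rfl⟩) hX
    · rw [hX, finrank_bot] at hdr
      omega
    · have := hdg a
      simp only at hX
      rw [hX, finrank_bot] at this
      omega
  · by_cases h : r v = 0
    · refine ⟨LinearMap.ker r, ⟨Set.mem_insert _ _, h⟩, ?_⟩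
      rintro X ⟨rfl | ⟨a, rfl⟩, hX⟩
      · rfl
      · refine absurd (hzero v ?_ h) hv
        simpa [h] using (hgv a v).1 hX
    · have h' : (r v : K) ≠ 0 := by simpa using h
      -- The only graph through `v` is the one with slope `p v / r v`.
      refine ⟨LinearMap.ker (g (p v / r v)), ⟨Or.inr ⟨_, rfl⟩, ?_⟩, ?_⟩
      · rw [hgv, div_mul_cancel₀ _ h']
      · rintro X ⟨rfl | ⟨a, rfl⟩, hX⟩
        · exact absurd hX h
        · rw [eq_div_of_mul_eq h' ((hgv a v).1 hX).symm]
  · exact ⟨_, Set.mem_insert _ _, hdr⟩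
  · rintro _ ⟨X, rfl | ⟨a, rfl⟩, rfl⟩
    · exact hdr.le
    · have := hdg a
      simp only
      omega
  · rw [Set.ncard_insert_of_notMem, ← Set.image_univ, Set.ncard_image_of_injective _ hinj,
      Set.ncard_univ, Module.natCard_eq_pow_finrank (K := F) (V := K), hK]
    -- The first factor is not a graph because `n - t < t`.
    rintro ⟨a, ha⟩
    have := hdg a
    simp only at ha
    rw [ha, hdr] at this
    omega

theorem IsSubspacePartition.top_eq_biUnion {P : Set (Submodule F V)}
    (hP : IsSubspacePartition P) (hne : P.Nonempty) :
    ((⊤ : Submodule F V) : Set V) = ⋃ U ∈ P, (U : Set V) := by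
  symm
  rw [Submodule.top_coe, Set.eq_univ_iff_forall]
  intro v
  rw [Set.mem_iUnion₂]
  by_cases hv : v = 0
  · obtain ⟨U, hU⟩ := hne
    exact ⟨U, hU, hv ▸ U.zero_mem⟩
  · obtain ⟨U, ⟨hU, hvU⟩, -⟩ := hP.2 v hv
    exact ⟨U, hU, hvU⟩

/-- With `n = dim V`, a member `U` of dimension `t` leaves `q ^ t * (q ^ (n - t) - 1)` points. Every
other member is disjoint from `U`, so it covers at most `q ^ (n - t) - 1` of them. -/
theorem IsSubspacePartition.pow_add_one_le_ncard {P : Set (Submodule F V)}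
    (hP : IsSubspacePartition P) {t : ℕ} (ht : t ∈ dimSet P) (hlt : t < finrank F V) :
    Nat.card F ^ t + 1 ≤ P.ncard := by
  classical
  have : Finite V := Module.finite_of_finite F
  have hfin : P.Finite := Set.toFinite P
  obtain ⟨U, hU, rfl⟩ := ht
  simp only at hlt ⊢
  obtain ⟨A, rfl⟩ := hfin.exists_finset_coe
  have hU' : U ∈ A := hU
  have h1 := sum_erase_pow_sub_one hP.pairwise_disjoint (hP.top_eq_biUnion ⟨U, hU⟩) hU'
  have h2 : ∑ X ∈ A.erase U, (Nat.card F ^ finrank F X - 1) ≤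
      (A.erase U).card * (Nat.card F ^ (finrank F V - finrank F U) - 1) := by
    rw [← smul_eq_mul]
    refine Finset.sum_le_card_nsmul _ _ _ fun X hX => Nat.sub_le_sub_right
      (Nat.pow_le_pow_right Nat.card_pos ?_) 1
    rw [← finrank_top F V]
    exact finrank_le_sub_of_disjoint (hP.pairwise_disjoint hU (Finset.mem_of_mem_erase hX)
      (Finset.ne_of_mem_erase hX).symm) le_top le_top
  rw [h1, finrank_top] at h2
  have hpos : 0 < Nat.card F ^ (finrank F V - finrank F U) - 1 :=
    Nat.sub_pos_of_lt (Nat.one_lt_pow (by omega) Finite.one_lt_card)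
  have h3 := Nat.le_of_mul_le_mul_right h2 hpos
  rw [Set.ncard_coe_finset, ← Finset.card_erase_add_one hU']
  omega

theorem minPartitionSize_eq (F : Type*) [Field F] [Finite F] {n t : ℕ} (h1 : t < n)
    (h2 : n < 2 * t) : minPartitionSize F n t = Nat.card F ^ t + 1 := by
  have hn : finrank F (Fin n → F) = n := finrank_fin_fun F
  refine le_antisymm (Nat.sInf_le ?_) (le_csInf ?_ ?_)
  · exact exists_isSubspacePartition (by rwa [hn]) (by rwa [hn])
  · exact ⟨_, exists_isSubspacePartition (F := F) (V := Fin n → F) (t := t) (by rwa [hn])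
      (by rwa [hn])⟩
  · rintro k ⟨P, hP, ht, rfl⟩
    exact hP.pow_add_one_le_ncard ht.1 (by rwa [hn])

/-! ### The structure of the supertail. -/

/-- If the union of `|U| + 1` pairwise disjoint subspaces, one of them `U`, is a subspace `W`, then
all of them except `U` have dimension `dim W - dim U`. -/
theorem finrank_eq_sub_of_card_eq {A : Finset (Submodule F V)}
    (hA : (A : Set (Submodule F V)).Pairwise Disjoint) {W : Submodule F V}
    (hW : (W : Set V) = ⋃ U ∈ A, (U : Set V)) {U : Submodule F V} (hU : U ∈ A)
    (hcard : A.card = Nat.card F ^ finrank F U + 1) {X : Submodule F V} (hX : X ∈ A)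
    (hXU : X ≠ U) : finrank F X = finrank F W - finrank F U := by
  classical
  have hsub : ∀ Y ∈ A, Y ≤ W := by
    intro Y hY v hv
    have : v ∈ (W : Set V) := hW ▸ Set.mem_biUnion hY hv
    exact this
  have hle : ∀ Y ∈ A.erase U, Nat.card F ^ finrank F Y - 1 ≤
      Nat.card F ^ (finrank F W - finrank F U) - 1 := by
    intro Y hY
    have hYA := Finset.mem_of_mem_erase hY
    exact Nat.sub_le_sub_right (Nat.pow_le_pow_right Nat.card_pos
      (finrank_le_sub_of_disjoint (hA hU hYA (Finset.ne_of_mem_erase hY).symm)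
        (hsub U hU) (hsub Y hYA))) 1
  have hsum := sum_erase_pow_sub_one hA hW hU
  -- The `q ^ t` other members, `t = dim U`, attain the maximal total, so each attains its own
  -- maximum.
  have hconst : ∑ Y ∈ A.erase U, (Nat.card F ^ finrank F Y - 1) =
      ∑ Y ∈ A.erase U, (Nat.card F ^ (finrank F W - finrank F U) - 1) := by
    rw [hsum, Finset.sum_const, Finset.card_erase_of_mem hU, hcard, Nat.add_sub_cancel,
      smul_eq_mul]
  have h := (Finset.sum_eq_sum_iff_of_le hle).1 hconst X (Finset.mem_erase.2 ⟨hXU, hX⟩)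
  have h1 : 0 < Nat.card F ^ finrank F X := pow_pos Nat.card_pos _
  have h2 : 0 < Nat.card F ^ (finrank F W - finrank F U) := pow_pos Nat.card_pos _
  exact Nat.pow_right_injective (Finite.one_lt_card : 2 ≤ Nat.card F) (by simp only; omega)

/-- A supertail of `q ^ t + 1` members, one of them of dimension `t`, fills a subspace. -/
theorem IsSubspacePartition.exists_eq_biUnion_supertail {P : Set (Submodule F V)}
    (hP : IsSubspacePartition P) {e : ℕ} (he : e ≤ finrank F V) {U : Submodule F V}
    (hU : U ∈ supertail P e) (hcard : (supertail P e).ncard = Nat.card F ^ finrank F U + 1) :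
    ∃ W : Submodule F V, (W : Set V) = ⋃ X ∈ supertail P e, (X : Set V) ∧
      (∀ X ∈ supertail P e, X ≤ W) ∧
      ∀ X ∈ supertail P e, X ≠ U → finrank F X = finrank F W - finrank F U := by
  have : Finite V := Module.finite_of_finite F
  obtain ⟨B, hB⟩ := (Set.toFinite P).exists_finset_coe
  obtain ⟨A, hA⟩ := (Set.toFinite (supertail P e)).exists_finset_coe
  have hAP : supertail P e ⊆ P := fun X hX => hX.1
  have hmem : ∀ {X}, X ∈ A ↔ X ∈ P ∧ finrank F X < e := by
    intro X
    rw [← Finset.mem_coe, hA]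
    rfl
  have hdisj : (A : Set (Submodule F V)).Pairwise Disjoint :=
    hA ▸ hP.pairwise_disjoint.mono hAP
  have hcardA : A.card = Nat.card F ^ finrank F U + 1 := by
    rw [← hcard, ← hA, Set.ncard_coe_finset]
  have hUcard : Nat.card U = Nat.card F ^ finrank F U := Module.natCard_eq_pow_finrank
  have hUA : U ∈ A := hmem.2 hU
  have hAB : A ⊆ B := by
    rw [← Finset.coe_subset, hA, hB]
    exact hAP
  have hmod : ∀ f : Dual F V, kernelWeight A f ≡ kernelWeight A 0 [MOD Nat.card F ^ e] := by
    refine IsSubspacePartition.modEq_kernelWeight (hB ▸ hP) hAB (fun X hX hXA => ?_) he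
    have hXP : X ∈ P := by rwa [← hB]
    by_contra! h
    exact hXA (hmem.2 ⟨hXP, h⟩)
  have hE : 2 * Nat.card U ≤ Nat.card F ^ e :=
    calc 2 * Nat.card U ≤ Nat.card F * Nat.card F ^ finrank F U := by
          rw [hUcard]
          exact Nat.mul_le_mul_right _ Finite.one_lt_card
      _ = Nat.card F ^ (finrank F U + 1) := (pow_succ' _ _).symm
      _ ≤ Nat.card F ^ e := Nat.pow_le_pow_right Nat.card_pos hU.2
  have hle := natCard_le_kernelWeight hdisj (fun X hX => hP.1 X (hmem.1 hX).1) hUA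
    (by rw [hcardA, hUcard]) hE fun f f' => (hmod f).trans (hmod f').symm
  have hW := coe_sup_eq_biUnion hdisj (by rw [hcardA, hUcard]) hle
  refine ⟨A.sup id, ?_, fun X hX => Finset.le_sup (f := id) (hmem.2 hX), fun X hX hXU =>
    finrank_eq_sub_of_card_eq hdisj hW hUA hcardA (hmem.2 hX) hXU⟩
  rw [hW, ← hA]
  simp only [Finset.mem_coe]

end

theorem mainTheorem1 {F V : Type*} [Field F] [Finite F] [AddCommGroup V] [Module F V]
    [FiniteDimensional F V] (q : ℕ) (hq : Nat.card F = q)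
    (P : Set (Submodule F V)) (hP : IsSubspacePartition P)
    (m : ℕ) (d : ℕ → ℕ) (hd : HasDims P m d)
    (s : ℕ) (hs : 2 ≤ s) (hsm : s ≤ m)
    (ST : Set (Submodule F V)) (hST : ST = supertail P (d s))
    (hcard : ST.ncard = minPartitionSize F (d s) (d (s - 1)))
    (hlt : d s < 2 * d (s - 1))
    (hcond : s - 1 ≤ 2 ∨ d s = 2 * d (s - 1) - 1 ∨
      ∃ k : ℕ, ∀ U ∈ P \ ST, Module.finrank F U = k) :
    ∃ W : Submodule F V, (W : Set V) = ⋃ U ∈ ST, (U : Set V) ∧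
      ((s - 1 = 1 ∧ numOfDim P (d 1) = q ^ d 1 + 1 ∧ Module.finrank F W = 2 * d 1) ∨
       (s - 1 = 2 ∧ numOfDim P (d 1) = q ^ d 2 ∧ numOfDim P (d 2) = 1 ∧
          Module.finrank F W = d 1 + d 2)) := by
  have : Finite V := Module.finite_of_finite F
  subst hq hST
  obtain ⟨hmono, himg⟩ := hd
  have hex : ∀ i, 1 ≤ i → i ≤ m → ∃ X ∈ P, finrank F X = d i := by
    intro i h1 h2
    have : d i ∈ dimSet P := himg ▸ Set.mem_image_of_mem d ⟨h1, h2⟩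
    exact this
  have hmon : ∀ {i j}, 1 ≤ i → i < j → j ≤ m → d i < d j := fun h1 h2 h3 =>
    hmono ⟨h1, by omega⟩ ⟨by omega, h3⟩ h2
  have hexT : ∀ i, 1 ≤ i → i < s → ∃ X ∈ supertail P (d s), finrank F X = d i := by
    intro i h1 h2
    obtain ⟨X, hX, hXd⟩ := hex i h1 (by omega)
    refine ⟨X, ⟨hX, ?_⟩, hXd⟩
    rw [hXd]
    exact hmon h1 h2 hsm
  have hdims : ∀ X ∈ supertail P (d s), ∃ i, 1 ≤ i ∧ i < s ∧ finrank F X = d i := by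
    rintro X ⟨hX, hXs⟩
    obtain ⟨i, ⟨h1, h2⟩, hi⟩ : finrank F X ∈ d '' Set.Icc 1 m := himg ▸ ⟨X, hX, rfl⟩
    refine ⟨i, h1, ?_, hi.symm⟩
    by_contra! h
    have := hmono.monotoneOn ⟨by omega, hsm⟩ ⟨h1, h2⟩ h
    omega
  have hts := hmon (i := s - 1) (j := s) (by omega) (by omega) hsm
  rw [minPartitionSize_eq F hts hlt] at hcard
  obtain ⟨U, hU, hUd⟩ := hexT (s - 1) (by omega) (by omega)
  have he : d s ≤ finrank F V := by
    obtain ⟨X, -, hX⟩ := hex s (by omega) hsm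
    exact hX ▸ Submodule.finrank_le X
  obtain ⟨W, hW, hsub, hdim⟩ := hP.exists_eq_biUnion_supertail he hU (by rw [hcard, hUd])
  rw [hUd] at hdim
  have hUW := Submodule.finrank_mono (hsub U hU)
  rw [hUd] at hUW
  refine ⟨W, hW, ?_⟩
  have hpos : 0 < Nat.card F ^ d (s - 1) := pow_pos Nat.card_pos _
  obtain ⟨Y, hY, hYU⟩ : ∃ Y ∈ supertail P (d s), Y ≠ U :=
    Set.exists_ne_of_one_lt_ncard (by omega) U
  have hYd := hdim Y hY hYU
  have hY0 : 0 < finrank F Y := by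
    rw [Nat.pos_iff_ne_zero, ne_eq, Submodule.finrank_eq_zero]
    exact hP.1 Y hY.1
  have hnum : ∀ i, 1 ≤ i → i < s →
      numOfDim P (d i) = {X ∈ supertail P (d s) | finrank F X = d i}.ncard := by
    intro i h1 h2
    have := hmon h1 h2 hsm
    rw [numOfDim]
    congr 1
    ext X
    simp only [supertail, Set.mem_ofPred_eq]
    constructor
    · rintro ⟨hX, hXd⟩
      exact ⟨⟨hX, by omega⟩, hXd⟩
    · rintro ⟨⟨hX, -⟩, hXd⟩
      exact ⟨hX, hXd⟩
  obtain ⟨j, hj1, hjs, hjd⟩ := hdims Y hY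
  -- All members other than `U` share the dimension `d j` of `Y`: if it is below `d (s - 1)`, two
  -- dimensions occur and `U` is the only large member; otherwise a single dimension occurs.
  rcases Nat.lt_or_ge j (s - 1) with hj | hj
  · right
    have hjt := hmon hj1 hj (by omega)
    have hsmall : ∀ i, 1 ≤ i → i < s - 1 → d i = d j := by
      intro i h1 h2
      obtain ⟨X, hX, hXd⟩ := hexT i h1 (by omega)
      have hit := hmon h1 h2 (by omega)
      have := hdim X hX (by rintro rfl; omega)
      omega
    obtain rfl : s = 3 := by
      by_contra hne
      have h1 := hsmall 1 le_rfl (by omega)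
      have h2 := hsmall 2 (by omega) (by omega)
      have := hmon (i := 1) (j := 2) le_rfl (by omega) (by omega)
      omega
    obtain rfl : j = 1 := by omega
    simp only [Nat.add_one_sub_one] at *
    refine ⟨trivial, ?_, ?_, by omega⟩
    · rw [hnum 1 le_rfl (by omega)]
      have : {X ∈ supertail P (d 3) | finrank F X = d 1} = supertail P (d 3) \ {U} := by
        ext X
        simp only [Set.mem_ofPred_eq, Set.mem_sdiff, Set.mem_singleton_iff]
        refine and_congr_right fun hX => ⟨?_, fun h => ?_⟩
        · rintro h rfl
          omega
        · rw [hdim X hX h]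
          omega
      rw [this, Set.ncard_sdiff_singleton_of_mem hU, hcard, Nat.add_sub_cancel]
    · rw [hnum 2 (by omega) (by omega), Set.ncard_eq_one]
      refine ⟨U, ?_⟩
      ext X
      simp only [Set.mem_ofPred_eq, Set.mem_singleton_iff]
      constructor
      · rintro ⟨hX, hXd⟩
        by_contra h
        have := hdim X hX h
        omega
      · rintro rfl
        exact ⟨hU, hUd⟩
  · left
    obtain rfl : j = s - 1 := by omega
    have hall : ∀ X ∈ supertail P (d s), finrank F X = d (s - 1) := by
      intro X hX
      by_cases h : X = U
      · rw [h, hUd]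
      · rw [hdim X hX h]
        omega
    obtain rfl : s = 2 := by
      by_contra hne
      obtain ⟨X, hX, hXd⟩ := hexT 1 le_rfl (by omega)
      have := hall X hX
      have := hmon (i := 1) (j := s - 1) le_rfl (by omega) (by omega)
      omega
    simp only [Nat.add_one_sub_one] at *
    refine ⟨trivial, ?_, by omega⟩
    rw [hnum 1 le_rfl (by omega), ← hcard]
    congr 1
    exact Set.sep_eq_self_iff_mem_true.2 hall
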